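/- Let $G$ be a compact real Lie group whose Lie algebra $\mathfrak{g}$ is semisimple (that is, has zero solvable radical), and let $\mathcal{D}:\mathfrak{g}\to\mathfrak{g}$ be any derivation of the Lie algebra $\mathfrak{g}$. Let $\mathcal{D}_{\mathbb{C}}$ denote the complexification of $\mathcal{D}$, acting on $\mathbb{C}\otimes_{\mathbb{R}}\mathfrak{g}$. Then: 1. Every eigenvalue $\mu\in\mathbb{C}$ of $\mathcal{D}_{\mathbb{C}}$ satisfies $\operatorname{Re}\mu=0$ and is semisimple, i.e. the generalized eigenspace of $\mathcal{D}_{\mathbb{C}}$ for $\mu$ equals the eigenspace of $\mathcal{D}_{\mathbb{C}}$ for $\mu$. 2. $\mathbb{C}\otimes_{\mathbb{R}}\mathfrak{g}$ has a basis consisting of eigenvectors of $\mathcal{D}_{\mathbb{C}}$, with eigenvalues in $i\mathbb{R}$. 3. In every Jordan basis of $\mathbb{C}\otimes_{\mathbb{R}}\mathfrak{g}$ for $\mathcal{D}_{\mathbb{C}}$, all Jordan blocks have size $1$. -/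

import Mathlib

open scoped Manifold ContDiff TensorProduct

/-- A smooth real Lie group is in particular smooth enough for its Lie algebra to be defined. -/
instance : ENat.LEInfty (minSmoothness ℝ 3) :=
  ⟨by rw [minSmoothness_of_isRCLikeNormedField]; exact ENat.LEInfty.out⟩

/-- The complexification of a real-linear endomorphism. Its eigenvalues and Jordan blocks are the
(complex) eigenvalues and complex Jordan blocks of the real endomorphism. -/
noncomputable abbrev complexify {V : Type*} [AddCommGroup V] [Module ℝ V] (T : V →ₗ[ℝ] V) :
    Module.End ℂ (ℂ ⊗[ℝ] V) :=
  LinearMap.baseChange ℂ T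

/-- `μ` is a semisimple eigenvalue of `T`: it is an eigenvalue, and its generalized eigenspace
consists of eigenvectors (together with zero). -/
def IsSemisimpleEigenvalue {W : Type*} [AddCommGroup W] [Module ℂ W]
    (T : Module.End ℂ W) (μ : ℂ) : Prop :=
  T.HasEigenvalue μ ∧ T.maxGenEigenspace μ = T.eigenspace μ

/-- `b` is a Jordan basis of `T` with `m` Jordan blocks, the `i`-th one having size `k i ≥ 1` and
eigenvalue `μ i`. -/
structure IsJordanBasis {W : Type*} [AddCommGroup W] [Module ℂ W] (T : Module.End ℂ W)
    {m : ℕ} (k : Fin m → ℕ) (μ : Fin m → ℂ)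
    (b : Module.Basis (Σ i : Fin m, Fin (k i)) ℂ W) : Prop where
  size_pos : ∀ i, 0 < k i
  apply_zero : ∀ (i : Fin m) (h : 0 < k i), T (b ⟨i, ⟨0, h⟩⟩) = μ i • b ⟨i, ⟨0, h⟩⟩
  apply_succ : ∀ (i : Fin m) (j : ℕ) (h : j + 1 < k i),
    T (b ⟨i, ⟨j + 1, h⟩⟩) = μ i • b ⟨i, ⟨j + 1, h⟩⟩ + b ⟨i, ⟨j, Nat.lt_of_succ_lt h⟩⟩

/-!
Averaging an inner product over the compact group `G` yields an inner product on the Lie algebra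
that is invariant under the adjoint representation. Since the derivative of `Ad` at the identity is
`ad`, every `ad z` is skew-adjoint for it. A Lie algebra with trivial radical has only inner
derivations, so every derivation is skew-adjoint: it is semisimple, because orthogonal complements
of invariant subspaces are invariant, and its spectrum is purely imaginary.

The derivative of `Ad` is computed in a chart centred at `1`, where multiplication becomes a germ
`m` with `m(0, y) = y = m(y, 0)`. The left-invariant vector fields are `y ↦ ∂₂m(y, 0) X`, so their
bracket is the antisymmetrization of the mixed second derivative of `m`. Differentiating
`∂₂m(y, 0) = ∂₁m(0, y) ∘ Ad y` at the identity gives the same expression.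
-/

section Complexification

variable {V : Type*} [AddCommGroup V] [Module ℝ V]

/-- The real part `z ⊗ v ↦ z.re • v` of a vector of the complexification of `V`. -/
noncomputable def complexificationRe : ℂ ⊗[ℝ] V →ₗ[ℝ] V :=
  (TensorProduct.lid ℝ V).toLinearMap ∘ₗ Complex.reLm.rTensor V

/-- The imaginary part `z ⊗ v ↦ z.im • v` of a vector of the complexification of `V`. -/
noncomputable def complexificationIm : ℂ ⊗[ℝ] V →ₗ[ℝ] V :=
  (TensorProduct.lid ℝ V).toLinearMap ∘ₗ Complex.imLm.rTensor V

@[simp]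
theorem complexificationRe_tmul (z : ℂ) (v : V) : complexificationRe (z ⊗ₜ[ℝ] v) = z.re • v := by
  simp [complexificationRe]

@[simp]
theorem complexificationIm_tmul (z : ℂ) (v : V) : complexificationIm (z ⊗ₜ[ℝ] v) = z.im • v := by
  simp [complexificationIm]

theorem one_tmul_complexificationRe_add_I_tmul_complexificationIm (w : ℂ ⊗[ℝ] V) :
    (1 : ℂ) ⊗ₜ[ℝ] complexificationRe w + Complex.I ⊗ₜ[ℝ] complexificationIm w = w := by
  induction w with
  | zero => simp
  | tmul z v =>
    rw [complexificationRe_tmul, complexificationIm_tmul, ← TensorProduct.smul_tmul,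
      ← TensorProduct.smul_tmul, ← TensorProduct.add_tmul]
    simp
  | add w w' hw hw' =>
    simp only [map_add, TensorProduct.tmul_add]
    rw [add_add_add_comm, hw, hw']

theorem eq_zero_of_complexificationRe_complexificationIm_eq_zero {w : ℂ ⊗[ℝ] V}
    (hre : complexificationRe w = 0) (him : complexificationIm w = 0) : w = 0 := by
  rw [← one_tmul_complexificationRe_add_I_tmul_complexificationIm w, hre, him]
  simp

theorem complexificationRe_smul (μ : ℂ) (w : ℂ ⊗[ℝ] V) :
    complexificationRe (μ • w) = μ.re • complexificationRe w - μ.im • complexificationIm w := by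
  induction w with
  | zero => simp
  | tmul z v => simp [TensorProduct.smul_tmul', sub_smul, mul_smul]
  | add w w' hw hw' => simp only [smul_add, map_add, hw, hw']; abel

theorem complexificationIm_smul (μ : ℂ) (w : ℂ ⊗[ℝ] V) :
    complexificationIm (μ • w) = μ.im • complexificationRe w + μ.re • complexificationIm w := by
  induction w with
  | zero => simp
  | tmul z v => simp [TensorProduct.smul_tmul', add_smul, mul_smul, add_comm]
  | add w w' hw hw' => simp only [smul_add, map_add, hw, hw']; abel

theorem complexificationRe_complexify (T : V →ₗ[ℝ] V) (w : ℂ ⊗[ℝ] V) :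
    complexificationRe (complexify T w) = T (complexificationRe w) := by
  induction w with
  | zero => simp
  | tmul z v => simp
  | add w w' hw hw' => simp only [map_add, hw, hw']

theorem complexificationIm_complexify (T : V →ₗ[ℝ] V) (w : ℂ ⊗[ℝ] V) :
    complexificationIm (complexify T w) = T (complexificationIm w) := by
  induction w with
  | zero => simp
  | tmul z v => simp
  | add w w' hw hw' => simp only [map_add, hw, hw']

end Complexification

section SkewAdjoint

theorem isSemisimple_of_isSkewAdjoint {K V : Type*} [Field K] [AddCommGroup V] [Module K V]
    [FiniteDimensional K V] {B : LinearMap.BilinForm K V} (hrefl : B.IsRefl)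
    (haniso : B.toQuadraticMap.Anisotropic) {T : Module.End K V} (hT : B.IsSkewAdjoint T) :
    T.IsSemisimple := by
  refine Module.End.isSemisimple_iff.mpr fun p hp => ⟨B.orthogonal p, fun x hx u hu => ?_, ?_⟩
  · have huT : B u ((-T) x) = 0 := (hT u x).symm.trans (hx (T u) (hp hu))
    simpa using huT
  · rw [LinearMap.BilinForm.isCompl_orthogonal_iff_disjoint hrefl, Submodule.disjoint_def]
    exact fun x hx hxp => haniso x (hxp x hx)

theorem re_eq_zero_of_hasEigenvalue_complexify {V : Type*} [AddCommGroup V] [Module ℝ V]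
    {B : LinearMap.BilinForm ℝ V} (hpos : B.toQuadraticMap.PosDef) {T : V →ₗ[ℝ] V}
    (hT : B.IsSkewAdjoint T) {μ : ℂ} (hμ : (complexify T).HasEigenvalue μ) : μ.re = 0 := by
  obtain ⟨w, hw⟩ := hμ.exists_hasEigenvector
  set x := complexificationRe w with hx
  set y := complexificationIm w with hy
  have hTx : T x = μ.re • x - μ.im • y := by
    rw [hx, ← complexificationRe_complexify, hw.apply_eq_smul, complexificationRe_smul]
  have hTy : T y = μ.im • x + μ.re • y := by
    rw [hy, ← complexificationIm_complexify, hw.apply_eq_smul, complexificationIm_smul]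
  have hxx := hT x x
  have hyy := hT y y
  simp only [hTx, hTy, Pi.neg_apply, map_neg, map_add, map_sub, map_smul, LinearMap.add_apply,
    LinearMap.sub_apply, LinearMap.smul_apply, smul_eq_mul] at hxx hyy
  have hsum : μ.re * (B x x + B y y) = 0 := by linarith
  refine (mul_eq_zero.mp hsum).resolve_right fun h0 => hw.2 ?_
  have hx0 := hpos.nonneg x
  have hy0 := hpos.nonneg y
  rw [LinearMap.BilinMap.toQuadraticMap_apply] at hx0 hy0
  refine eq_zero_of_complexificationRe_complexificationIm_eq_zero (hpos.anisotropic x ?_)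
    (hpos.anisotropic y ?_) <;> rw [LinearMap.BilinMap.toQuadraticMap_apply] <;> linarith

theorem isSkewAdjoint_lieDerivation_of_lieInvariant {K L : Type*} [Field K] [LieRing L]
    [LieAlgebra K L] [FiniteDimensional K L] [LieAlgebra.IsKilling K L]
    {B : LinearMap.BilinForm K L} (hB : B.lieInvariant L) (D : LieDerivation K L L) :
    B.IsSkewAdjoint D.toLinearMap := by
  obtain ⟨z, rfl⟩ := LieDerivation.IsKilling.exists_eq_ad D
  intro x y
  simpa [← map_neg] using hB z x y

end SkewAdjoint

section Semisimple

theorem isSemisimple_baseChange {K A V : Type*} [Field K] [PerfectField K] [Field A] [Algebra K A]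
    [AddCommGroup V] [Module K V] [FiniteDimensional K V] {T : Module.End K V}
    (hT : T.IsSemisimple) : Module.End.IsSemisimple (LinearMap.baseChange A T) := by
  have hsep : (minpoly K T).Separable :=
    PerfectField.separable_iff_squarefree.mpr hT.minpoly_squarefree
  refine Module.End.isSemisimple_of_squarefree_aeval_eq_zero hsep.map.squarefree
    (p := (minpoly K T).map (algebraMap K A)) ?_
  calc Polynomial.aeval (LinearMap.baseChange A T) ((minpoly K T).map (algebraMap K A))
      = Polynomial.aeval (Module.End.baseChangeHom K A V T) (minpoly K T) :=
        Polynomial.aeval_map_algebraMap ..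
    _ = Module.End.baseChangeHom K A V (Polynomial.aeval T (minpoly K T)) :=
        Polynomial.aeval_algHom_apply ..
    _ = 0 := by rw [minpoly.aeval, map_zero]

theorem exists_basis_hasEigenvector_of_isSemisimple {K W : Type*} [Field K] [IsAlgClosed K]
    [AddCommGroup W] [Module K W] [FiniteDimensional K W] {S : Module.End K W}
    (hS : S.IsSemisimple) :
    ∃ (b : Module.Basis (Fin (Module.finrank K W)) K W) (μ : Fin (Module.finrank K W) → K),
      ∀ i, S.HasEigenvector (μ i) (b i) := by
  let eigenvectors : Set W := {w | ∃ μ, S.HasEigenvector μ w}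
  have hspan : ⊤ ≤ Submodule.span K eigenvectors := by
    rw [← hS.iSup_eigenspace_eq_top]
    refine iSup_le fun μ w hw => ?_
    by_cases h0 : w = 0
    · exact h0 ▸ zero_mem _
    · exact Submodule.subset_span ⟨μ, hw, h0⟩
  let b := Module.Basis.ofSpan hspan
  let e := b.indexEquiv (Module.finBasis K W)
  have hb : ∀ i, ∃ μ, S.HasEigenvector μ (b.reindex e i) := fun i => by
    rw [b.reindex_apply]
    exact Module.Basis.ofSpan_subset hspan ⟨_, rfl⟩
  choose μ hμ using hb
  exact ⟨b.reindex e, μ, hμ⟩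

theorem IsJordanBasis.size_eq_one_of_isSemisimple {W : Type*} [AddCommGroup W] [Module ℂ W]
    {S : Module.End ℂ W} (hS : S.IsSemisimple) {m : ℕ} {k : Fin m → ℕ} {μ : Fin m → ℂ}
    {b : Module.Basis (Σ i : Fin m, Fin (k i)) ℂ W} (hb : IsJordanBasis S k μ b) (i : Fin m) :
    k i = 1 := by
  by_contra hne
  have h0 : 0 < k i := hb.size_pos i
  have h1 : 0 + 1 < k i := by omega
  have happly_zero := hb.apply_zero i h0
  have happly_one := hb.apply_succ i 0 h1
  have hgen : b ⟨i, ⟨0 + 1, h1⟩⟩ ∈ S.maxGenEigenspace (μ i) := by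
    refine S.mem_maxGenEigenspace (μ i) _ |>.mpr ⟨2, ?_⟩
    simp [pow_two, happly_one, happly_zero]
  rw [hS.isFinitelySemisimple.maxGenEigenspace_eq_eigenspace, Module.End.mem_eigenspace_iff,
    happly_one, add_eq_left] at hgen
  exact b.ne_zero _ hgen

end Semisimple

section InvariantForm

open MeasureTheory

set_option maxSynthPendingDepth 3

variable {G E : Type*} [Group G] [TopologicalSpace G] [NormedAddCommGroup E] [NormedSpace ℝ E]

theorem continuous_bilinearComp_inv [IsTopologicalGroup G] {ρ : G →* (E →L[ℝ] E)}
    (hρ : Continuous ρ) (B₀ : E →L[ℝ] E →L[ℝ] ℝ) :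
    Continuous fun g => B₀.bilinearComp (ρ g⁻¹) (ρ g⁻¹) := by
  have hρ_inv : Continuous fun g => ρ g⁻¹ := hρ.comp continuous_inv
  exact (ContinuousLinearMap.flipₗᵢ ℝ E E ℝ).continuous.comp
    (((ContinuousLinearMap.flipₗᵢ ℝ E E ℝ).continuous.comp
      (continuous_const.clm_comp hρ_inv)).clm_comp hρ_inv)

variable [MeasurableSpace G]

/-- The average over `G` of the translates of the bilinear form `B₀` under the representation `ρ`.
The inverse makes left invariance of the measure the relevant one. -/
noncomputable def averagedForm (μ : Measure G) (ρ : G →* (E →L[ℝ] E))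
    (B₀ : E →L[ℝ] E →L[ℝ] ℝ) : E →L[ℝ] E →L[ℝ] ℝ :=
  ∫ g, B₀.bilinearComp (ρ g⁻¹) (ρ g⁻¹) ∂μ

variable [IsTopologicalGroup G] [CompactSpace G] [BorelSpace G]
  (μ : Measure G) {ρ : G →* (E →L[ℝ] E)} (hρ : Continuous ρ) (B₀ : E →L[ℝ] E →L[ℝ] ℝ)

include hρ

theorem averagedForm_apply [IsFiniteMeasureOnCompacts μ] (x y : E) :
    averagedForm μ ρ B₀ x y = ∫ g, B₀ (ρ g⁻¹ x) (ρ g⁻¹ y) ∂μ := by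
  have hint : Integrable (fun g => B₀.bilinearComp (ρ g⁻¹) (ρ g⁻¹)) μ :=
    (continuous_bilinearComp_inv hρ B₀).integrable_of_hasCompactSupport
      (HasCompactSupport.of_compactSpace _)
  rw [averagedForm, ContinuousLinearMap.integral_apply hint,
    ContinuousLinearMap.integral_apply (hint.apply_continuousLinearMap x)]
  rfl

theorem averagedForm_map_map [IsFiniteMeasureOnCompacts μ] [μ.IsMulLeftInvariant] (h : G)
    (x y : E) : averagedForm μ ρ B₀ (ρ h x) (ρ h y) = averagedForm μ ρ B₀ x y := by
  simp only [averagedForm_apply μ hρ]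
  rw [← integral_mul_left_eq_self _ h]
  simp [← mul_apply_eq_comp, ← map_mul]

theorem averagedForm_self_pos [μ.IsOpenPosMeasure] [IsFiniteMeasureOnCompacts μ]
    (hB₀ : ∀ x ≠ 0, 0 < B₀ x x) {x : E} (hx : x ≠ 0) : 0 < averagedForm μ ρ B₀ x x := by
  have hcont : Continuous fun g => B₀ (ρ g⁻¹ x) (ρ g⁻¹ x) :=
    ((continuous_bilinearComp_inv hρ B₀).clm_apply continuous_const).clm_apply continuous_const
  have hnonneg : ∀ v, 0 ≤ B₀ v v := fun v => by
    rcases eq_or_ne v 0 with rfl | hv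
    · simp
    · exact (hB₀ v hv).le
  rw [averagedForm_apply μ hρ]
  refine hcont.integral_pos_of_hasCompactSupport_nonneg_nonzero
    (HasCompactSupport.of_compactSpace _) (fun g => hnonneg _) (x := 1) ?_
  simpa using (hB₀ x hx).ne'

end InvariantForm

section CompactGroup

theorem exists_symm_pos_bilinearForm (E : Type*) [NormedAddCommGroup E] [NormedSpace ℝ E]
    [FiniteDimensional ℝ E] :
    ∃ B : E →L[ℝ] E →L[ℝ] ℝ, (∀ x y, B x y = B y x) ∧ ∀ x ≠ 0, 0 < B x x := by
  let e : E →L[ℝ] EuclideanSpace ℝ (Fin (Module.finrank ℝ E)) :=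
    (toEuclidean (E := E)).toContinuousLinearMap
  refine ⟨(innerSL ℝ).bilinearComp e e, fun x y => real_inner_comm (e y) (e x), fun x hx => ?_⟩
  have hex : e x ≠ 0 := by simpa [e] using hx
  exact real_inner_self_pos.mpr hex

theorem exists_invariant_symm_pos_bilinearForm {G E : Type*} [Group G] [TopologicalSpace G]
    [IsTopologicalGroup G] [CompactSpace G] [NormedAddCommGroup E] [NormedSpace ℝ E]
    [FiniteDimensional ℝ E] {ρ : G →* (E →L[ℝ] E)} (hρ : Continuous ρ) :
    ∃ B : E →L[ℝ] E →L[ℝ] ℝ, (∀ x y, B x y = B y x) ∧ (∀ x ≠ 0, 0 < B x x) ∧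
      ∀ g x y, B (ρ g x) (ρ g y) = B x y := by
  borelize G
  obtain ⟨B₀, hsymm, hpos⟩ := exists_symm_pos_bilinearForm E
  let μ : MeasureTheory.Measure G := MeasureTheory.Measure.haar
  refine ⟨averagedForm μ ρ B₀, fun x y => ?_, fun x => averagedForm_self_pos μ hρ B₀ hpos,
    averagedForm_map_map μ hρ B₀⟩
  simp only [averagedForm_apply μ hρ, hsymm]

end CompactGroup

section InfinitesimalInvariance

theorem apply_fderiv_eq_neg_of_invariant {𝕜 E F : Type*} [NontriviallyNormedField 𝕜]
    [NormedAddCommGroup E] [NormedSpace 𝕜 E] [NormedAddCommGroup F] [NormedSpace 𝕜 F]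
    {B : E →L[𝕜] E →L[𝕜] 𝕜} {A : F → E →L[𝕜] E} {t : F}
    (hB : ∀ s x y, B (A s x) (A s y) = B x y) (hA : DifferentiableAt 𝕜 A t)
    (hAt : A t = ContinuousLinearMap.id 𝕜 E) (z : F) (x y : E) :
    B (fderiv 𝕜 A t z x) y = -B x (fderiv 𝕜 A t z y) := by
  have happly (v : E) : HasFDerivAt (fun s => A s v) ((fderiv 𝕜 A t).flip v) t := by
    simpa using hA.hasFDerivAt.clm_apply (hasFDerivAt_const v t)
  have hderiv := B.hasFDerivAt_of_bilinear (happly x) (happly y)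
  simp only [hB] at hderiv
  have hz := DFunLike.congr_fun (hderiv.unique (hasFDerivAt_const (B x y) t)) z
  simp only [hAt] at hz
  rw [eq_neg_iff_add_eq_zero, add_comm]
  simpa using hz

end InfinitesimalInvariance

section PartialDerivatives

open scoped Topology
open ContinuousLinearMap (inl inr precomp)

variable {𝕜 E E' F : Type*} [NontriviallyNormedField 𝕜] [NormedAddCommGroup E] [NormedSpace 𝕜 E]
  [NormedAddCommGroup E'] [NormedSpace 𝕜 E'] [NormedAddCommGroup F] [NormedSpace 𝕜 F]
  {f : E × E' → F} {a : E} {b : E'}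

theorem eventually_differentiableAt_of_contDiffAt {n : WithTop ℕ∞} {g : E → F}
    (hg : ContDiffAt 𝕜 n g a) (hn : 1 ≤ n) : ∀ᶠ x in 𝓝 a, DifferentiableAt 𝕜 g x :=
  ((hg.of_le hn).eventually (by simp)).mono fun _ hx => hx.differentiableAt one_ne_zero

theorem eventually_hasFDerivAt_prodMk_left
    (hf : ∀ᶠ p in 𝓝 (a, b), DifferentiableAt 𝕜 f p) :
    ∀ᶠ y in 𝓝 b, HasFDerivAt (fun x => f (x, y)) (fderiv 𝕜 f (a, y) ∘L inl 𝕜 E E') a := by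
  have hcont : ContinuousAt (fun y => (a, y)) b := by fun_prop
  filter_upwards [hcont.eventually hf] with y hy
  exact hy.hasFDerivAt.comp a (hasFDerivAt_prodMk_left a y)

theorem eventually_hasFDerivAt_prodMk_right
    (hf : ∀ᶠ p in 𝓝 (a, b), DifferentiableAt 𝕜 f p) :
    ∀ᶠ x in 𝓝 a, HasFDerivAt (fun y => f (x, y)) (fderiv 𝕜 f (x, b) ∘L inr 𝕜 E E') b := by
  have hcont : ContinuousAt (fun x => (x, b)) a := by fun_prop
  filter_upwards [hcont.eventually hf] with x hx
  exact hx.hasFDerivAt.comp b (hasFDerivAt_prodMk_right x b)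

theorem hasFDerivAt_fderiv_prodMk_left (hf : ContDiffAt 𝕜 2 f (a, b)) :
    HasFDerivAt (fun y => fderiv 𝕜 (fun x => f (x, y)) a)
      (precomp F (inl 𝕜 E E') ∘L fderiv 𝕜 (fderiv 𝕜 f) (a, b) ∘L inr 𝕜 E E') b := by
  have hf' : DifferentiableAt 𝕜 (fderiv 𝕜 f) (a, b) :=
    (hf.fderiv_right (m := 1) (by norm_num)).differentiableAt (by simp)
  refine ((precomp F (inl 𝕜 E E')).hasFDerivAt.comp b
    (hf'.hasFDerivAt.comp b (hasFDerivAt_prodMk_right a b))).congr_of_eventuallyEq ?_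
  exact (eventually_hasFDerivAt_prodMk_left
    (eventually_differentiableAt_of_contDiffAt hf one_le_two)).mono fun _ hy => hy.fderiv

theorem hasFDerivAt_fderiv_prodMk_right (hf : ContDiffAt 𝕜 2 f (a, b)) :
    HasFDerivAt (fun x => fderiv 𝕜 (fun y => f (x, y)) b)
      (precomp F (inr 𝕜 E E') ∘L fderiv 𝕜 (fderiv 𝕜 f) (a, b) ∘L inl 𝕜 E E') a := by
  have hf' : DifferentiableAt 𝕜 (fderiv 𝕜 f) (a, b) :=
    (hf.fderiv_right (m := 1) (by norm_num)).differentiableAt (by simp)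
  refine ((precomp F (inr 𝕜 E E')).hasFDerivAt.comp a
    (hf'.hasFDerivAt.comp a (hasFDerivAt_prodMk_left a b))).congr_of_eventuallyEq ?_
  exact (eventually_hasFDerivAt_prodMk_right
    (eventually_differentiableAt_of_contDiffAt hf one_le_two)).mono fun _ hx => hx.fderiv

theorem fderiv_fderiv_prodMk_comm (hf : ContDiffAt 𝕜 (minSmoothness 𝕜 2) f (a, b)) (u : E)
    (v : E') :
    fderiv 𝕜 (fun y => fderiv 𝕜 (fun x => f (x, y)) a) b v u =
      fderiv 𝕜 (fun x => fderiv 𝕜 (fun y => f (x, y)) b) a u v := by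
  have hf2 : ContDiffAt 𝕜 2 f (a, b) := hf.of_le le_minSmoothness
  rw [(hasFDerivAt_fderiv_prodMk_left hf2).fderiv, (hasFDerivAt_fderiv_prodMk_right hf2).fderiv]
  exact (hf.isSymmSndFDerivAt le_rfl).eq _ _

end PartialDerivatives

section ExtChartAt

open scoped Topology

variable {𝕜 : Type*} [NontriviallyNormedField 𝕜]
  {E : Type*} [NormedAddCommGroup E] [NormedSpace 𝕜 E] {H : Type*} [TopologicalSpace H]
  {I : ModelWithCorners 𝕜 E H} [I.Boundaryless]
  {M : Type*} [TopologicalSpace M] [ChartedSpace H M]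
  {E' : Type*} [NormedAddCommGroup E'] [NormedSpace 𝕜 E'] {H' : Type*} [TopologicalSpace H']
  {I' : ModelWithCorners 𝕜 E' H'} {M' : Type*} [TopologicalSpace M'] [ChartedSpace H' M']

theorem mfderiv_eq_fderiv_extChartAt {f : M → M'} {x : M} {y : M'}
    (hf : MDifferentiableAt I I' f x) (hy : f x = y) :
    (mfderiv I I' f x : E →L[𝕜] E') =
      fderiv 𝕜 (extChartAt I' y ∘ f ∘ (extChartAt I x).symm) (extChartAt I x x) := by
  subst hy
  rw [hf.mfderiv, I.range_eq_univ, fderivWithin_univ]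
  rfl

theorem contMDiffAt_extChartAt_symm {n : WithTop ℕ∞} [IsManifold I n M] (x : M) :
    ContMDiffAt 𝓘(𝕜, E) I n (extChartAt I x).symm (extChartAt I x x) :=
  (contMDiffOn_extChartAt_symm x).contMDiffAt (extChartAt_target_mem_nhds x)

end ExtChartAt

section AdjointRepresentation

open scoped Topology

variable {𝕜 : Type*} [NontriviallyNormedField 𝕜]
  {E : Type*} [NormedAddCommGroup E] [NormedSpace 𝕜 E]
  {H : Type*} [TopologicalSpace H] (I : ModelWithCorners 𝕜 E H)
  {G : Type*} [Group G] [TopologicalSpace G] [ChartedSpace H G]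

variable (𝕜) in
theorem minSmoothness_three_ne_zero : minSmoothness 𝕜 3 ≠ 0 :=
  (lt_of_lt_of_le (by simp) le_minSmoothness).ne'

theorem contMDiff_conj {n : WithTop ℕ∞} [LieGroup I n G] (g : G) :
    ContMDiff I I n (MulAut.conj g) :=
  (contMDiff_const.mul contMDiff_id).mul contMDiff_const

theorem mdifferentiableAt_conj [LieGroup I (minSmoothness 𝕜 3) G] (g x : G) :
    MDifferentiableAt I I (MulAut.conj g) x :=
  (contMDiff_conj (n := minSmoothness 𝕜 3) I g).mdifferentiableAt (minSmoothness_three_ne_zero 𝕜)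

/-- The adjoint representation of a Lie group `G`: the action of `G` on the tangent space at the
identity by the derivative of conjugation. That tangent space is by definition the model space
`E`, and is written so here in order to make its norm available. -/
noncomputable def adjointRep [LieGroup I (minSmoothness 𝕜 3) G] : G →* (E →L[𝕜] E) where
  toFun g := mfderiv I I (MulAut.conj g) 1
  map_one' := by
    rw [map_one, MulAut.coe_one]
    exact mfderiv_id
  map_mul' g h := by
    have hbase : (mfderiv I I (MulAut.conj g) (MulAut.conj h 1) : E →L[𝕜] E) =
        mfderiv I I (MulAut.conj g) 1 :=
      mfderiv_congr_point (map_one _)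
    rw [map_mul, MulAut.coe_mul]
    exact (mfderiv_comp 1 (mdifferentiableAt_conj I g _) (mdifferentiableAt_conj I h 1)).trans
      (congrArg (fun A : E →L[𝕜] E => A ∘L mfderiv I I (MulAut.conj h) 1) hbase)

/-- Conjugation by `g`, read in the preferred chart at the identity; meaningful only near the
image of the identity, outside of which chart and inverse chart take junk values. -/
noncomputable def chartConj (g : G) (z : E) : E :=
  extChartAt I (1 : G) (MulAut.conj g ((extChartAt I (1 : G)).symm z))

variable (G) in
/-- The multiplication, read in the preferred chart at the identity; like `chartConj`, meaningful
only near the image of the identity. -/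
noncomputable def chartMul (p : E × E) : E :=
  extChartAt I (1 : G) ((extChartAt I (1 : G)).symm p.1 * (extChartAt I (1 : G)).symm p.2)

theorem chartConj_extChartAt_one (g : G) :
    chartConj I g (extChartAt I (1 : G) 1) = extChartAt I (1 : G) 1 := by
  simp [chartConj]

theorem eventually_extChartAt_symm_chartConj {n : WithTop ℕ∞} [LieGroup I n G] (g : G) :
    ∀ᶠ z in 𝓝 (extChartAt I (1 : G) 1), (extChartAt I (1 : G)).symm (chartConj I g z) =
      MulAut.conj g ((extChartAt I (1 : G)).symm z) := by
  have hcont : ContinuousAt (MulAut.conj g ∘ (extChartAt I (1 : G)).symm)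
      (extChartAt I (1 : G) 1) :=
    (contMDiff_conj (n := n) I g).continuous.continuousAt.comp (continuousAt_extChartAt_symm 1)
  have hsource : (extChartAt I (1 : G)).source ∈
      𝓝 (MulAut.conj g ((extChartAt I (1 : G)).symm (extChartAt I (1 : G) 1))) := by
    simpa using extChartAt_source_mem_nhds (I := I) (1 : G)
  filter_upwards [hcont hsource] with z hz
  exact (extChartAt I (1 : G)).left_inv hz

variable [I.Boundaryless]

theorem fderiv_chartMul_right_one :
    fderiv 𝕜 (fun z => chartMul I G (extChartAt I (1 : G) 1, z)) (extChartAt I (1 : G) 1) =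
      ContinuousLinearMap.id 𝕜 E := by
  rw [← fderiv_id (x := extChartAt I (1 : G) 1)]
  refine Filter.EventuallyEq.fderiv_eq ?_
  filter_upwards [extChartAt_target_mem_nhds (I := I) (1 : G)] with y hy
  simpa [chartMul] using (extChartAt I (1 : G)).right_inv hy

theorem fderiv_chartMul_left_one :
    fderiv 𝕜 (fun z => chartMul I G (z, extChartAt I (1 : G) 1)) (extChartAt I (1 : G) 1) =
      ContinuousLinearMap.id 𝕜 E := by
  rw [← fderiv_id (x := extChartAt I (1 : G) 1)]
  refine Filter.EventuallyEq.fderiv_eq ?_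
  filter_upwards [extChartAt_target_mem_nhds (I := I) (1 : G)] with y hy
  simpa [chartMul] using (extChartAt I (1 : G)).right_inv hy

theorem contMDiffAt_chartConj {n : WithTop ℕ∞} [LieGroup I n G] (g : G) :
    ContMDiffAt (I.prod 𝓘(𝕜, E)) 𝓘(𝕜, E) n (Function.uncurry (chartConj (G := G) I))
      (g, extChartAt I (1 : G) 1) := by
  have hconj : ContMDiffAt (I.prod 𝓘(𝕜, E)) I n
      (fun p : G × E => p.1 * (extChartAt I (1 : G)).symm p.2 * p.1⁻¹)
      (g, extChartAt I (1 : G) 1) :=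
    (contMDiffAt_fst.mul ((contMDiffAt_extChartAt_symm (1 : G)).comp
      (g, extChartAt I (1 : G) 1) contMDiffAt_snd)).mul contMDiffAt_fst.inv
  exact contMDiffAt_extChartAt.comp_of_eq hconj (by simp)

theorem contDiffAt_chartMul {n : WithTop ℕ∞} [LieGroup I n G] :
    ContDiffAt 𝕜 n (chartMul I G) (extChartAt I (1 : G) 1, extChartAt I (1 : G) 1) := by
  rw [← contMDiffAt_iff_contDiffAt]
  have hsymm : ContMDiffAt 𝓘(𝕜, E) I n (extChartAt I (1 : G)).symm (extChartAt I (1 : G) 1) :=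
    contMDiffAt_extChartAt_symm (1 : G)
  have hmul : ContMDiffAt 𝓘(𝕜, E × E) I n
      (fun p : E × E => (extChartAt I (1 : G)).symm p.1 * (extChartAt I (1 : G)).symm p.2)
      (extChartAt I (1 : G) 1, extChartAt I (1 : G) 1) :=
    (hsymm.comp_of_eq contDiffAt_fst.contMDiffAt rfl).mul
      (hsymm.comp_of_eq contDiffAt_snd.contMDiffAt rfl)
  exact contMDiffAt_extChartAt.comp_of_eq hmul (by simp)

theorem differentiableAt_chartConj {n : WithTop ℕ∞} [LieGroup I n G] (hn : n ≠ 0) (g : G) :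
    DifferentiableAt 𝕜 (chartConj I g) (extChartAt I (1 : G) 1) := by
  have h : ContMDiffAt 𝓘(𝕜, E) 𝓘(𝕜, E) n (chartConj I g) (extChartAt I (1 : G) 1) :=
    (contMDiffAt_chartConj I g).comp_of_eq (f := fun z => (g, z))
      (contMDiffAt_const.prodMk contMDiffAt_id) rfl
  exact h.contDiffAt.differentiableAt hn

variable [LieGroup I (minSmoothness 𝕜 3) G]

theorem adjointRep_eq_fderiv_chartConj (g : G) :
    adjointRep I g = fderiv 𝕜 (chartConj I g) (extChartAt I (1 : G) 1) :=
  mfderiv_eq_fderiv_extChartAt (mdifferentiableAt_conj I g 1) (map_one _)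

theorem contMDiff_adjointRep :
    ContMDiff I 𝓘(𝕜, E →L[𝕜] E) (minSmoothness 𝕜 2) (adjointRep (G := G) I) := by
  intro g
  have hn : minSmoothness 𝕜 2 + 1 ≤ minSmoothness 𝕜 3 := by
    rw [← minSmoothness_add]
    norm_num
  have h := ContMDiffAt.mfderiv (chartConj (G := G) I) (fun _ => extChartAt I (1 : G) 1)
    (contMDiffAt_chartConj I g) contMDiffAt_const hn
  have htangent := inTangentCoordinates_model_space (I := 𝓘(𝕜, E)) (I' := 𝓘(𝕜, E))
    (fun _ : G => extChartAt I (1 : G) 1) (fun x : G => chartConj I x (extChartAt I (1 : G) 1))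
    (adjointRep I) g
  simp only [mfderiv_eq_fderiv, ← adjointRep_eq_fderiv_chartConj] at h
  exact (congrArg (ContMDiffAt I 𝓘(𝕜, E →L[𝕜] E) (minSmoothness 𝕜 2) · g) htangent).mp h

theorem differentiableAt_adjointRep_extChartAt_symm :
    DifferentiableAt 𝕜 (fun y => adjointRep I ((extChartAt I (1 : G)).symm y))
      (extChartAt I (1 : G) 1) := by
  have : IsManifold I 1 G := inferInstance
  have hrep : MDifferentiableAt I 𝓘(𝕜, E →L[𝕜] E) (adjointRep I) (1 : G) :=
    (contMDiff_adjointRep I).mdifferentiableAt (lt_of_lt_of_le (by simp) le_minSmoothness).ne'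
  have hsymm : MDifferentiableAt 𝓘(𝕜, E) I (extChartAt I (1 : G)).symm (extChartAt I (1 : G) 1) :=
    (contMDiffAt_extChartAt_symm (n := 1) (1 : G)).mdifferentiableAt one_ne_zero
  exact (hrep.comp_of_eq _ hsymm (extChartAt_to_inv 1)).differentiableAt

end AdjointRepresentation

section BracketInChart

open scoped Topology
open VectorField

variable {𝕜 : Type*} [NontriviallyNormedField 𝕜]
  {E : Type*} [NormedAddCommGroup E] [NormedSpace 𝕜 E] {H : Type*} [TopologicalSpace H]
  {I : ModelWithCorners 𝕜 E H}

theorem mpullbackWithin_extChartAt_symm_apply {M : Type*} [TopologicalSpace M]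
    [ChartedSpace H M] [IsManifold I 1 M] {x : M} (V : Π y : M, TangentSpace I y) {z : E}
    (hz : z ∈ (extChartAt I x).target) :
    mpullbackWithin 𝓘(𝕜, E) I (extChartAt I x).symm V (Set.range I) z =
      mfderiv I 𝓘(𝕜, E) (extChartAt I x) ((extChartAt I x).symm z) (V _) := by
  rw [mpullbackWithin_apply, ContinuousLinearMap.inverse_eq
    (mfderivWithin_extChartAt_symm_comp_mfderiv_extChartAt hz)
    (mfderiv_extChartAt_comp_mfderivWithin_extChartAt_symm hz)]
  rfl

variable [I.Boundaryless]

theorem mlieBracket_eq_lieBracket_extChartAt {M : Type*} [TopologicalSpace M]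
    [ChartedSpace H M] [IsManifold I 1 M] {V W : Π y : M, TangentSpace I y} {x : M}
    {V' W' : E → E}
    (hV : mpullbackWithin 𝓘(𝕜, E) I (extChartAt I x).symm V (Set.range I)
      =ᶠ[𝓝 (extChartAt I x x)] V')
    (hW : mpullbackWithin 𝓘(𝕜, E) I (extChartAt I x).symm W (Set.range I)
      =ᶠ[𝓝 (extChartAt I x x)] W') :
    mlieBracket I V W x = lieBracket 𝕜 V' W' (extChartAt I x x) := by
  have hinv (v : E) : (mfderiv I 𝓘(𝕜, E) (extChartAt I x) x : E →L[𝕜] E).inverse v = v := by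
    have hchart : (mfderiv I 𝓘(𝕜, E) (extChartAt I x) x : E →L[𝕜] E) =
      ContinuousLinearMap.id 𝕜 E := mfderiv_extChartAt_self
    exact (congrArg (fun A : E →L[𝕜] E => A.inverse v) hchart).trans (by simp)
  have hrange (V₁ V₂ : E → E) :
      lieBracketWithin 𝕜 V₁ V₂ (Set.range I) = lieBracket 𝕜 V₁ V₂ := by
    rw [I.range_eq_univ, lieBracketWithin_univ]
  rw [mlieBracket, mlieBracketWithin_apply, Set.preimage_univ, Set.univ_inter]
  exact (hinv _).trans ((congrFun (hrange _ _) _).trans (hV.lieBracket_vectorField_eq hW))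

variable {G : Type*} [Group G] [TopologicalSpace G] [ChartedSpace H G]
  [LieGroup I (minSmoothness 𝕜 3) G]

theorem mpullbackWithin_mulInvariantVectorField (X : GroupLieAlgebra I G) {y : E}
    (hy : y ∈ (extChartAt I (1 : G)).target) :
    mpullbackWithin 𝓘(𝕜, E) I (extChartAt I (1 : G)).symm (mulInvariantVectorField X)
        (Set.range I) y =
      fderiv 𝕜 (fun z => chartMul I G (y, z)) (extChartAt I (1 : G) 1) X := by
  have : IsManifold I 1 G := inferInstance
  set g := (extChartAt I (1 : G)).symm y
  have hmul : MDifferentiableAt I I (g * ·) 1 :=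
    (contMDiff_mul_left (I := I) (n := minSmoothness 𝕜 3)).mdifferentiableAt
      (minSmoothness_three_ne_zero 𝕜)
  have hchart : MDifferentiableAt I 𝓘(𝕜, E) (extChartAt I (1 : G)) (g * 1) := by
    refine mdifferentiableAt_extChartAt ?_
    rw [mul_one, ← extChartAt_source I]
    exact (extChartAt I (1 : G)).map_target hy
  have hcomp := mfderiv_comp (1 : G) hchart hmul
  have hval := mfderiv_eq_fderiv_extChartAt (hchart.comp 1 hmul) rfl
  have hbase : (mfderiv I 𝓘(𝕜, E) (extChartAt I (1 : G)) (g * 1) : E →L[𝕜] E) =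
      mfderiv I 𝓘(𝕜, E) (extChartAt I (1 : G)) g :=
    mfderiv_congr_point (mul_one g)
  rw [mpullbackWithin_extChartAt_symm_apply _ hy]
  exact (congrArg (fun A : E →L[𝕜] E => A (mulInvariantVectorField X g)) hbase).symm.trans
    (congrArg (fun A : E →L[𝕜] E => A X) (hcomp.symm.trans hval))

theorem groupLieAlgebra_bracket_eq_lieBracket_chartMul (Z X : GroupLieAlgebra I G) :
    ⁅Z, X⁆ = lieBracket 𝕜
      (fun y => fderiv 𝕜 (fun z => chartMul I G (y, z)) (extChartAt I (1 : G) 1) Z)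
      (fun y => fderiv 𝕜 (fun z => chartMul I G (y, z)) (extChartAt I (1 : G) 1) X)
      (extChartAt I (1 : G) 1) := by
  have : IsManifold I 1 G := inferInstance
  have hchart (W : GroupLieAlgebra I G) :
      mpullbackWithin 𝓘(𝕜, E) I (extChartAt I (1 : G)).symm (mulInvariantVectorField W)
        (Set.range I) =ᶠ[𝓝 (extChartAt I (1 : G) 1)]
      fun y => fderiv 𝕜 (fun z => chartMul I G (y, z)) (extChartAt I (1 : G) 1) W :=
    Filter.eventuallyEq_of_mem (extChartAt_target_mem_nhds (1 : G)) fun y hy =>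
      mpullbackWithin_mulInvariantVectorField W hy
  rw [GroupLieAlgebra.bracket_def]
  exact mlieBracket_eq_lieBracket_extChartAt (hchart Z) (hchart X)

end BracketInChart

section AdjointDerivative

open scoped Topology
open VectorField ContinuousLinearMap

variable {𝕜 : Type*} [NontriviallyNormedField 𝕜]
  {E : Type*} [NormedAddCommGroup E] [NormedSpace 𝕜 E] {H : Type*} [TopologicalSpace H]
  {I : ModelWithCorners 𝕜 E H} [I.Boundaryless]
  {G : Type*} [Group G] [TopologicalSpace G] [ChartedSpace H G]
  [LieGroup I (minSmoothness 𝕜 3) G]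

theorem contDiffAt_minSmoothness_two_chartMul :
    ContDiffAt 𝕜 (minSmoothness 𝕜 2) (chartMul I G)
      (extChartAt I (1 : G) 1, extChartAt I (1 : G) 1) :=
  (contDiffAt_chartMul (n := minSmoothness 𝕜 3) I).of_le (minSmoothness_monotone (by norm_cast))

theorem eventually_fderiv_chartMul_right_eq_comp_adjointRep :
    ∀ᶠ y in 𝓝 (extChartAt I (1 : G) 1),
      fderiv 𝕜 (fun z => chartMul I G (y, z)) (extChartAt I (1 : G) 1) =
        fderiv 𝕜 (fun z => chartMul I G (z, y)) (extChartAt I (1 : G) 1) ∘L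
          adjointRep I ((extChartAt I (1 : G)).symm y) := by
  have hdiff := eventually_hasFDerivAt_prodMk_left (eventually_differentiableAt_of_contDiffAt
    (contDiffAt_chartMul (G := G) (n := minSmoothness 𝕜 3) I)
    (le_trans (by norm_num) (le_minSmoothness (𝕜 := 𝕜) (n := 3))))
  filter_upwards [hdiff] with y hy
  have hconj := chartConj_extChartAt_one I ((extChartAt I (1 : G)).symm y)
  -- Left translation by `g` is conjugation by `g` followed by right translation by `g`.
  have hfactor : (fun z => chartMul I G (y, z)) =ᶠ[𝓝 (extChartAt I (1 : G) 1)]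
      (fun z => chartMul I G (z, y)) ∘ chartConj I ((extChartAt I (1 : G)).symm y) := by
    filter_upwards [eventually_extChartAt_symm_chartConj (n := minSmoothness 𝕜 3) I
      ((extChartAt I (1 : G)).symm y)] with z hz
    simp only [Function.comp_apply, chartMul, hz, MulAut.conj_apply, inv_mul_cancel_right]
  rw [hfactor.fderiv_eq, adjointRep_eq_fderiv_chartConj, fderiv_comp _ _
    (differentiableAt_chartConj I (minSmoothness_three_ne_zero 𝕜) _), hconj]
  rw [hconj]
  exact hy.differentiableAt

theorem fderiv_adjointRep_eq_sub (Z X : E) :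
    fderiv 𝕜 (fun y => adjointRep I ((extChartAt I (1 : G)).symm y)) (extChartAt I (1 : G) 1) Z X =
      fderiv 𝕜 (fun y => fderiv 𝕜 (fun z => chartMul I G (y, z)) (extChartAt I (1 : G) 1))
          (extChartAt I (1 : G) 1) Z X -
        fderiv 𝕜 (fun y => fderiv 𝕜 (fun z => chartMul I G (z, y)) (extChartAt I (1 : G) 1))
          (extChartAt I (1 : G) 1) Z X := by
  have hM : ContDiffAt 𝕜 2 (chartMul I G) (extChartAt I (1 : G) 1, extChartAt I (1 : G) 1) :=
    contDiffAt_minSmoothness_two_chartMul.of_le le_minSmoothness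
  have hleft := (hasFDerivAt_fderiv_prodMk_left hM).differentiableAt.hasFDerivAt
  have hrep := (differentiableAt_adjointRep_extChartAt_symm (G := G) I).hasFDerivAt
  have hprod := (hleft.clm_comp hrep).congr_of_eventuallyEq
    eventually_fderiv_chartMul_right_eq_comp_adjointRep
  rw [hprod.fderiv]
  simp only [add_apply, comp_apply, flip_apply, compL_apply, extChartAt_to_inv, map_one,
    one_def, comp_id, fderiv_chartMul_left_one, id_apply, add_sub_cancel_right]

theorem fderiv_adjointRep_eq_lieBracket (Z X : E) :
    fderiv 𝕜 (fun y => adjointRep I ((extChartAt I (1 : G)).symm y)) (extChartAt I (1 : G) 1) Z X =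
      lieBracket 𝕜 (fun y => fderiv 𝕜 (fun z => chartMul I G (y, z)) (extChartAt I (1 : G) 1) Z)
        (fun y => fderiv 𝕜 (fun z => chartMul I G (y, z)) (extChartAt I (1 : G) 1) X)
        (extChartAt I (1 : G) 1) := by
  have hM := contDiffAt_minSmoothness_two_chartMul (I := I) (G := G)
  have hright (U : E) := (hasFDerivAt_fderiv_prodMk_right
    (hM.of_le le_minSmoothness)).differentiableAt.hasFDerivAt.clm_apply
      (hasFDerivAt_const U (extChartAt I (1 : G) 1))
  rw [fderiv_adjointRep_eq_sub, lieBracket, (hright X).fderiv, (hright Z).fderiv,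
    fderiv_fderiv_prodMk_comm hM]
  simp only [flip_apply, comp_zero, zero_add, fderiv_chartMul_right_one, id_apply]

theorem fderiv_adjointRep_eq_lie (Z X : GroupLieAlgebra I G) :
    fderiv 𝕜 (fun y => adjointRep I ((extChartAt I (1 : G)).symm y)) (extChartAt I (1 : G) 1) Z X =
      ⁅Z, X⁆ :=
  (fderiv_adjointRep_eq_lieBracket (E := E) Z X).trans
    (groupLieAlgebra_bracket_eq_lieBracket_chartMul (I := I) (G := G) Z X).symm

end AdjointDerivative

section CompactLieGroup

variable {E : Type*} [NormedAddCommGroup E] [NormedSpace ℝ E] [FiniteDimensional ℝ E]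
  {H : Type*} [TopologicalSpace H] (I : ModelWithCorners ℝ E H) [I.Boundaryless]
  (G : Type*) [Group G] [TopologicalSpace G] [ChartedSpace H G]
  [LieGroup I (minSmoothness ℝ 3) G] [CompactSpace G]

theorem exists_lieInvariant_posDef_bilinForm :
    ∃ B : LinearMap.BilinForm ℝ (GroupLieAlgebra I G),
      B.IsRefl ∧ B.toQuadraticMap.PosDef ∧ B.lieInvariant (GroupLieAlgebra I G) := by
  have : IsTopologicalGroup G := topologicalGroup_of_lieGroup I (minSmoothness ℝ 3)
  obtain ⟨B, hsymm, hpos, hinv⟩ :=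
    exists_invariant_symm_pos_bilinearForm (contMDiff_adjointRep (G := G) I).continuous
  refine ⟨B.toLinearMap₁₂, fun x y hxy => (hsymm y x).trans hxy, hpos, fun z x y => ?_⟩
  have hskew := apply_fderiv_eq_neg_of_invariant
    (fun s => hinv ((extChartAt I (1 : G)).symm s))
    (differentiableAt_adjointRep_extChartAt_symm (G := G) I)
    (by rw [extChartAt_to_inv, map_one, ContinuousLinearMap.one_def]) z x y
  rw [fderiv_adjointRep_eq_lie, fderiv_adjointRep_eq_lie] at hskew
  exact hskew

theorem mainTheorem3_general [LieAlgebra.HasTrivialRadical ℝ (GroupLieAlgebra I G)]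
    (D : LieDerivation ℝ (GroupLieAlgebra I G) (GroupLieAlgebra I G)) :
    (∀ μ : ℂ, (complexify D.toLinearMap).HasEigenvalue μ →
      IsSemisimpleEigenvalue (complexify D.toLinearMap) μ ∧ μ.re = 0) ∧
    (∃ (n : ℕ) (b : Module.Basis (Fin n) ℂ (ℂ ⊗[ℝ] GroupLieAlgebra I G)) (θ : Fin n → ℝ),
      ∀ i, complexify D.toLinearMap (b i) = ((θ i : ℂ) * Complex.I) • b i) ∧
    (∀ (m : ℕ) (k : Fin m → ℕ) (μ : Fin m → ℂ)
      (b : Module.Basis (Σ i : Fin m, Fin (k i)) ℂ (ℂ ⊗[ℝ] GroupLieAlgebra I G)),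
      IsJordanBasis (complexify D.toLinearMap) k μ b → ∀ i, k i = 1) := by
  have : FiniteDimensional ℝ (GroupLieAlgebra I G) := inferInstanceAs (FiniteDimensional ℝ E)
  obtain ⟨B, hrefl, hpos, hinv⟩ := exists_lieInvariant_posDef_bilinForm I G
  have hskew := isSkewAdjoint_lieDerivation_of_lieInvariant hinv D
  have hss : (complexify D.toLinearMap).IsSemisimple :=
    isSemisimple_baseChange (isSemisimple_of_isSkewAdjoint hrefl hpos.anisotropic hskew)
  have hre : ∀ μ : ℂ, (complexify D.toLinearMap).HasEigenvalue μ → μ.re = 0 :=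
    fun _ => re_eq_zero_of_hasEigenvalue_complexify hpos hskew
  refine ⟨fun μ hμ => ⟨⟨hμ, hss.isFinitelySemisimple.maxGenEigenspace_eq_eigenspace μ⟩, hre μ hμ⟩,
    ?_, fun m k μ b hb => hb.size_eq_one_of_isSemisimple hss⟩
  obtain ⟨b, μ, hb⟩ := exists_basis_hasEigenvector_of_isSemisimple hss
  refine ⟨_, b, fun i => (μ i).im, fun i => ?_⟩
  have hμ : μ i = (μ i).im * Complex.I := by
    simp [Complex.ext_iff, hre (μ i) (Module.End.hasEigenvalue_of_hasEigenvector (hb i))]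
  rw [← hμ, (hb i).apply_eq_smul]

end CompactLieGroup

theorem mainTheorem3
    {E : Type*} [NormedAddCommGroup E] [NormedSpace ℝ E] [FiniteDimensional ℝ E]
    {H : Type*} [TopologicalSpace H] (I : ModelWithCorners ℝ E H) [I.Boundaryless]
    (G : Type*) [Group G] [TopologicalSpace G] [ChartedSpace H G] [LieGroup I ∞ G]
    [CompactSpace G] [LieAlgebra.HasTrivialRadical ℝ (GroupLieAlgebra I G)]
    (D : LieDerivation ℝ (GroupLieAlgebra I G) (GroupLieAlgebra I G)) :
    (∀ μ : ℂ, (complexify D.toLinearMap).HasEigenvalue μ →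
      IsSemisimpleEigenvalue (complexify D.toLinearMap) μ ∧ μ.re = 0) ∧
    (∃ (n : ℕ) (b : Module.Basis (Fin n) ℂ (ℂ ⊗[ℝ] GroupLieAlgebra I G)) (θ : Fin n → ℝ),
      ∀ i, complexify D.toLinearMap (b i) = ((θ i : ℂ) * Complex.I) • b i) ∧
    (∀ (m : ℕ) (k : Fin m → ℕ) (μ : Fin m → ℂ)
      (b : Module.Basis (Σ i : Fin m, Fin (k i)) ℂ (ℂ ⊗[ℝ] GroupLieAlgebra I G)),
      IsJordanBasis (complexify D.toLinearMap) k μ b → ∀ i, k i = 1) :=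
  mainTheorem3_general I G D
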